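/- Let $n$ be a natural number and let $\mathscr F$ be a saturated singular holomorphic distribution of dimension two on the complex projective space $\mathbb P^n$, that is, an exact sequence of coherent sheaves $$0\to T\mathscr F\to T\mathbb P^n\to N\mathscr F\to 0,$$ where $T\mathscr F$ has rank $2$ and $N\mathscr F$ is torsion free of rank $n-2\ge 1$. Suppose that $\mathscr F$ has degree zero, where $\deg(\mathscr F)=c_1(N\mathscr F)-(n-2)-1$. Then one of the following holds: 1. $\mathscr F$ is integrable, i.e. $[T\mathscr F,T\mathscr F]\subset T\mathscr F$, and it is tangent to a linear projection $\mathbb P^n\dashrightarrow\mathbb P^{n-2}$: there is a surjective linear map $L:\mathbb C^{n+1}\to\mathbb C^{n-1}$ such that $T\mathscr F$ is the sheaf of the vector fields that are tangent to the fibres of the rational map $[z]\mapsto[L(z)]$; 2. $n=3$ and $\mathscr F$ is a contact structure on $\mathbb P^3$: locally $T\mathscr F$ is the kernel of a holomorphic $1$-form $\alpha$ such that $\alpha\wedge d\alpha$ vanishes nowhere. -/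

import Mathlib

open Topology TopologicalSpace Filter
open scoped LinearAlgebra.Projectivization

/-- Complex projective space `P^n`, the space of lines through `0` in `ℂ^{n+1}`. -/
abbrev CProj (n : ℕ) : Type := ℙ ℂ (Fin (n + 1) → ℂ)

/-- The usual topology of `P^n`: the quotient topology from `ℂ^{n+1} \ {0}`. -/
instance instTopologicalSpaceCProj (n : ℕ) : TopologicalSpace (CProj n) :=
  inferInstanceAs
    (TopologicalSpace (Quotient (projectivizationSetoid ℂ (Fin (n + 1) → ℂ))))

/-- The cone `π⁻¹(U) ⊆ ℂ^{n+1} \ {0}` over a set `U` of points of `P^n`. -/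
def coneOver {n : ℕ} (U : Opens (CProj n)) : Set (Fin (n + 1) → ℂ) :=
  {z | ∃ hz : z ≠ 0, Projectivization.mk ℂ z hz ∈ U}

/-- `f` represents a section over `U` of the structure sheaf of `P^n`: a holomorphic function on
the cone over `U` which is homogeneous of degree `0`. (Values off the cone are irrelevant.) -/
def IsRegularOn {n : ℕ} (U : Opens (CProj n)) (f : (Fin (n + 1) → ℂ) → ℂ) : Prop :=
  DifferentiableOn ℂ f (coneOver U) ∧ ∀ z ∈ coneOver U, ∀ c : ℂ, c ≠ 0 → f (c • z) = f z

/-- `v` represents a section over `U` of `O(1)^{n+1}`: a holomorphic vector field on the cone over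
`U` which is homogeneous of degree `1`, i.e. invariant under the dilations. By the Euler sequence
`0 → O → O(1)^{n+1} → TP^n → 0`, where `1 ∈ O` goes to the radial field `z ↦ z`, such fields
modulo multiples of the radial field are the vector fields of `P^n`, and Lie brackets of such fields
induce the Lie brackets of the vector fields of `P^n`. -/
def IsHomogeneousField {n : ℕ} (U : Opens (CProj n))
    (v : (Fin (n + 1) → ℂ) → (Fin (n + 1) → ℂ)) : Prop :=
  DifferentiableOn ℂ v (coneOver U) ∧
    ∀ z ∈ coneOver U, ∀ c : ℂ, c ≠ 0 → v (c • z) = c • v z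

/-- A saturated singular holomorphic distribution `0 → TF → TP^n → NF → 0` of dimension `s` on
`P^n`: a coherent subsheaf `TF` of rank `s` of `TP^n`, with `1 ≤ s`, whose quotient `NF` is
torsion free and nontrivial, i.e. of rank `n - s ≥ 1`.

The subsheaves of the quotient `TP^n = O(1)^{n+1} / O · (radial field)` are the subsheaves of
`O(1)^{n+1}` that contain the radial field. `TF` is given in this way: `sec U` is the set of the
homogeneous lifts to the cone over `U` of the sections of `TF` over `U`. -/
structure HolomorphicDistribution (n s : ℕ) where
  /-- The homogeneous lifts of the sections of the tangent sheaf over `U`. -/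
  sec : Opens (CProj n) → Set ((Fin (n + 1) → ℂ) → (Fin (n + 1) → ℂ))
  homogeneous : ∀ U, ∀ v ∈ sec U, IsHomogeneousField U v
  -- the sheaf property
  restrict : ∀ U W : Opens (CProj n), W ≤ U → ∀ v ∈ sec U, v ∈ sec W
  glue : ∀ (U : Opens (CProj n)) (v : (Fin (n + 1) → ℂ) → (Fin (n + 1) → ℂ)),
    IsHomogeneousField U v →
    (∀ p ∈ U, ∃ W : Opens (CProj n), W ≤ U ∧ p ∈ W ∧
      ∃ w ∈ sec W, Set.EqOn v w (coneOver W)) → v ∈ sec U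
  -- a submodule over the structure sheaf that contains the radial field
  add_mem : ∀ U, ∀ v ∈ sec U, ∀ w ∈ sec U, v + w ∈ sec U
  smul_mem : ∀ U, ∀ f, IsRegularOn U f → ∀ v ∈ sec U, (fun z => f z • v z) ∈ sec U
  radial_mem : ∀ U, (fun z => z) ∈ sec U
  -- coherence: a subsheaf of a coherent sheaf is coherent when it is locally finitely generated
  coherent : ∀ p : CProj n, ∃ U : Opens (CProj n), p ∈ U ∧
    ∃ (r : ℕ) (g : Fin r → (Fin (n + 1) → ℂ) → (Fin (n + 1) → ℂ)), (∀ i, g i ∈ sec U) ∧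
      ∀ W : Opens (CProj n), W ≤ U → ∀ v ∈ sec W, ∀ q ∈ W,
        ∃ W' : Opens (CProj n), W' ≤ W ∧ q ∈ W' ∧
          ∃ f : Fin r → (Fin (n + 1) → ℂ) → ℂ, (∀ i, IsRegularOn W' (f i)) ∧
            ∀ z ∈ coneOver W', v z = ∑ i, f i z • g i z
  -- saturation: the quotient `NF` is torsion free
  saturated : ∀ U, ∀ f, IsRegularOn U f → interior {z ∈ coneOver U | f z = 0} = ∅ →
    ∀ v, IsHomogeneousField U v → (fun z => f z • v z) ∈ sec U → v ∈ sec U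
  -- `TF` has rank `s`: the lifts (which include the radial field) span `s + 1` dimensions
  -- at a generic point
  generic_rank : Dense {z : Fin (n + 1) → ℂ | Module.finrank ℂ (Submodule.span ℂ
    {x : Fin (n + 1) → ℂ | ∃ U : Opens (CProj n), z ∈ coneOver U ∧ ∃ v ∈ sec U, v z = x}) = s + 1}
  dim_pos : 1 ≤ s
  dim_lt : s < n

namespace HolomorphicDistribution

variable {n s : ℕ}

/-- With `k = n - s` the codimension: `ω` is a section of `Ω^k(m)` over `P^n`, written as a
holomorphic `k`-form on `ℂ^{n+1} \ {0}` that is homogeneous of degree `m` (with `z` and `dz` both of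
degree `1`) and is annihilated by the radial field, such that contraction of `ω` with `TF` vanishes
and the zero set of `ω` has codimension at least `2`.

So `ω` is a morphism `Λ^k NF → O(m)` which is an isomorphism outside an analytic set of codimension
at least `2`; that is, `ω` exhibits `O(m)` as the determinant of `NF`. -/
structure IsDeterminantForm (F : HolomorphicDistribution n s) (m : ℤ)
    (ω : (Fin (n + 1) → ℂ) → (Fin (n + 1) → ℂ) [⋀^Fin (n - s)]→L[ℂ] ℂ) : Prop where
  holomorphic : DifferentiableOn ℂ ω {0}ᶜ
  homogeneous : ∀ z, z ≠ 0 → ∀ c : ℂ, c ≠ 0 →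
    ω (c • z) = c ^ (m - ((n - s : ℕ) : ℤ)) • ω z
  radial : ∀ z, z ≠ 0 → ∀ (x : Fin (n - s) → Fin (n + 1) → ℂ) (i : Fin (n - s)),
    x i = z → ω z x = 0
  annihilates : ∀ U, ∀ v ∈ F.sec U, ∀ z ∈ coneOver U,
    ∀ (x : Fin (n - s) → Fin (n + 1) → ℂ) (i : Fin (n - s)), x i = v z → ω z x = 0
  -- the analytic set `{ω = 0}` contains no germ of a hypersurface `{f = 0}` (nor an open set: `f = 0`)
  codim_two : ∀ p, p ≠ 0 → ∀ f : (Fin (n + 1) → ℂ) → ℂ, AnalyticAt ℂ f p → f p = 0 →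
    ∃ᶠ z in 𝓝 p, f z = 0 ∧ ω z ≠ 0

/-- `c₁(NF) = m`, i.e. `det NF ≅ O(m)`. -/
def HasNormalChernClass (F : HolomorphicDistribution n s) (m : ℤ) : Prop :=
  ∃ ω, F.IsDeterminantForm m ω

/-- `deg F = d`, where `deg F = c₁(NF) - codim F - 1`. -/
def HasDegree (F : HolomorphicDistribution n s) (d : ℤ) : Prop :=
  F.HasNormalChernClass (d + ((n - s : ℕ) : ℤ) + 1)

/-- `F` is integrable: `[TF, TF] ⊆ TF`. -/
def IsIntegrable (F : HolomorphicDistribution n s) : Prop :=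
  ∀ U, ∀ v ∈ F.sec U, ∀ w ∈ F.sec U, VectorField.lieBracket ℂ v w ∈ F.sec U

/-- `F` is tangent to a linear projection `P^n ⇢ P^m`: for a surjective linear map
`L : ℂ^{n+1} → ℂ^{m+1}`, the sections of `TF` are the vector fields that are tangent to the fibres
of `[z] ↦ [L z]`, i.e. that the differential of this map, defined where `L z ≠ 0`, kills. -/
def IsTangentToLinearProjection (F : HolomorphicDistribution n s) (m : ℕ) : Prop :=
  ∃ L : (Fin (n + 1) → ℂ) →ₗ[ℂ] (Fin (m + 1) → ℂ), Function.Surjective L ∧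
    ∀ U v, IsHomogeneousField U v →
      (v ∈ F.sec U ↔ ∀ z ∈ coneOver U, L z ≠ 0 → L (v z) ∈ Submodule.span ℂ {L z})

/-- `F` is a contact structure: locally on `P^n`, `TF` is the kernel of a nowhere vanishing
holomorphic `1`-form `α` such that `dα` is nondegenerate on the hyperplane `ker α` of the tangent
space at every point; on a threefold, this is `α ∧ dα ≠ 0`. Forms on `W ⊆ P^n` are written as forms
on the cone over `W` that are invariant under dilations and annihilated by the radial field;
`T_{[z]} P^n` is `ℂ^{n+1} / ℂ z`. -/
def IsContact (F : HolomorphicDistribution n s) : Prop :=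
  ∀ p : CProj n, ∃ W : Opens (CProj n), p ∈ W ∧
    ∃ α : (Fin (n + 1) → ℂ) → ((Fin (n + 1) → ℂ) →L[ℂ] ℂ),
      DifferentiableOn ℂ α (coneOver W) ∧
      (∀ z ∈ coneOver W, ∀ c : ℂ, c ≠ 0 → α (c • z) = c⁻¹ • α z) ∧
      (∀ z ∈ coneOver W, α z z = 0) ∧
      (∀ z ∈ coneOver W, α z ≠ 0) ∧
      (∀ U, U ≤ W → ∀ v, IsHomogeneousField U v →
        (v ∈ F.sec U ↔ ∀ z ∈ coneOver U, α z (v z) = 0)) ∧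
      ∀ z ∈ coneOver W, ∀ x, α z x = 0 →
        (∀ y, α z y = 0 → fderiv ℂ α z x y - fderiv ℂ α z y x = 0) →
        x ∈ Submodule.span ℂ {z}

end HolomorphicDistribution

/-! Write `V` for ℂ^{n+1} and `k = n - 2`. In degree zero the determinant form has coefficients
homogeneous of degree one, and a holomorphic map on `V \ {0}` with that homogeneity is linear, by
Liouville on complex lines. Since `ω z` is killed by `z`, the linear map `z ↦ ω z` is the
contraction of a constant `(k + 1)`-form with `z` (`exists_linear_form_of_hasDegree_zero`).
Saturation and Cramer's rule recover `F` as the sheaf of all fields with values in the kernels of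
the `ω z` (`mem_sec_of_forall_mem_kernel`), so the rest is linear algebra.

For generic `z` the kernel `K` of `ω z` has dimension three (`two_le_finrank_ker_or_ker_eq_bot`). If
any two vectors of `K` annihilate each other, all `ω u` with `u ∈ K` are multiples of `ω z`, hence
`ker ω` has dimension at least two. It then has dimension exactly two, and `F` is tangent to the
projection along it. Otherwise some `a, b ∈ K` do not annihilate each other. This forces `k = 1` and
`ker ω = 0`: a symplectic form on ℂ⁴, whose contraction with the radial field is a contact form on
the projective threefold. -/

/-! ### Holomorphic functions of several variables and homogeneity. -/

section SeveralComplexVariables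

open Metric MeasureTheory

variable {E F : Type*} [NormedAddCommGroup E] [NormedSpace ℂ E]
  [NormedAddCommGroup F] [NormedSpace ℂ F]

/-- The restriction of a function to a complex line, as a function of the parameter. -/
theorem DifferentiableAt.comp_line {f : E → F} {z y : E} {t : ℂ}
    (hf : DifferentiableAt ℂ f (z + t • y)) :
    HasDerivAt (fun t : ℂ => f (z + t • y)) (fderiv ℂ f (z + t • y) y) t := by
  have h : HasDerivAt (fun t : ℂ => z + t • y) y t := by
    simpa using ((hasDerivAt_id t).smul_const y).const_add z
  exact hf.hasFDerivAt.comp_hasDerivAt t h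

/-- Cauchy's estimate for the Fréchet derivative. -/
theorem norm_fderiv_le_of_forall_mem_ball_norm_le {f : E → F} {z : E} {ρ R M : ℝ} (hρ : 0 < ρ)
    (hR : ρ < R) (hf : DifferentiableOn ℂ f (ball z R)) (hM : ∀ w ∈ ball z R, ‖f w‖ ≤ M) :
    ‖fderiv ℂ f z‖ ≤ M / ρ := by
  have hM0 : 0 ≤ M := (norm_nonneg _).trans (hM z (mem_ball_self (hρ.trans hR)))
  refine ContinuousLinearMap.opNorm_le_bound _ (by positivity) fun y => ?_
  rcases eq_or_ne y 0 with rfl | hy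
  · simp
  have hy' : 0 < ‖y‖ := norm_pos_iff.2 hy
  have hin : ∀ t ∈ closedBall (0 : ℂ) (ρ / ‖y‖), z + t • y ∈ ball z R := by
    intro t ht
    rw [mem_closedBall_zero_iff, le_div_iff₀ hy'] at ht
    simpa [norm_smul] using ht.trans_lt hR
  have hd : ∀ t ∈ closedBall (0 : ℂ) (ρ / ‖y‖),
      HasDerivAt (fun t : ℂ => f (z + t • y)) (fderiv ℂ f (z + t • y) y) t := fun t ht =>
    (hf.differentiableAt (isOpen_ball.mem_nhds (hin t ht))).comp_line
  have h0 := hd 0 (mem_closedBall_self (by positivity))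
  have h1 : DiffContOnCl ℂ (fun t : ℂ => f (z + t • y)) (ball 0 (ρ / ‖y‖)) :=
    DifferentiableOn.diffContOnCl fun t ht =>
      (hd t (closure_ball_subset_closedBall ht)).differentiableAt.differentiableWithinAt
  have h2 := Complex.norm_deriv_le_of_forall_mem_sphere_norm_le (C := M)
    (div_pos hρ hy') h1 fun t ht => hM _ (hin t (sphere_subset_closedBall ht))
  rw [h0.deriv] at h2
  simp only [zero_smul, add_zero] at h2
  calc ‖fderiv ℂ f z y‖ ≤ M / (ρ / ‖y‖) := h2
    _ = M / ρ * ‖y‖ := by field_simp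

/-- The derivatives of a holomorphic function of several variables are holomorphic. -/
theorem DifferentiableOn.fderiv_apply_const [FiniteDimensional ℂ E] [FiniteDimensional ℂ F]
    {f : E → F} {U : Set E} (hf : DifferentiableOn ℂ f U) (hU : IsOpen U) (x : E) :
    DifferentiableOn ℂ (fun z => fderiv ℂ f z x) U := by
  intro z₀ hz₀
  refine DifferentiableAt.differentiableWithinAt ?_
  have : ProperSpace E := FiniteDimensional.proper ℂ E
  have : CompleteSpace F := FiniteDimensional.complete ℂ F
  have hcont := hf.continuousOn.continuousAt (hU.mem_nhds hz₀)
  obtain ⟨ε, hε, hball⟩ := Metric.mem_nhds_iff.1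
    (inter_mem (hU.mem_nhds hz₀) (hcont (ball_mem_nhds (f z₀) one_pos)))
  -- Base points stay within `ρ` of `z₀`, the circle of integration moves them by less than `ρ`, and
  -- Cauchy's estimate there needs a further ball of radius `2 * ρ`.
  obtain ⟨ρ, hρ, rfl⟩ : ∃ ρ : ℝ, 0 < ρ ∧ 4 * ρ = ε := ⟨ε / 4, by positivity, by ring⟩
  have hUball : ball z₀ (4 * ρ) ⊆ U := fun z hz => (hball hz).1
  have hM : ∀ z ∈ ball z₀ (4 * ρ), ‖f z‖ ≤ ‖f z₀‖ + 1 := by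
    intro z hz
    have h1 : ‖f z - f z₀‖ < 1 := mem_ball_iff_norm.1 (hball hz).2
    linarith [norm_le_insert' (f z) (f z₀)]
  have hC : ∀ z ∈ ball z₀ (2 * ρ), ‖fderiv ℂ f z‖ ≤ (‖f z₀‖ + 1) / ρ := by
    intro z hz
    have hsub : ball z (2 * ρ) ⊆ ball z₀ (4 * ρ) :=
      ball_subset_ball' (by rw [mem_ball] at hz; linarith)
    exact norm_fderiv_le_of_forall_mem_ball_norm_le hρ (by linarith)
      (hf.mono (hsub.trans hUball)) fun w hw => hM w (hsub hw)
  set C := (‖f z₀‖ + 1) / ρ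
  obtain ⟨r, hr, hrx⟩ : ∃ r : ℝ, 0 < r ∧ r * ‖x‖ < ρ := by
    refine ⟨ρ / (‖x‖ + 1), by positivity, ?_⟩
    rw [div_mul_eq_mul_div, div_lt_iff₀ (by positivity)]
    nlinarith
  have hin : ∀ z ∈ ball z₀ ρ, ∀ ζ : ℂ, ‖ζ‖ ≤ r → z + ζ • x ∈ ball z₀ (2 * ρ) := by
    intro z hz ζ hζ
    have h1 : ‖ζ • x‖ < ρ := by
      rw [norm_smul]
      exact (mul_le_mul_of_nonneg_right hζ (norm_nonneg x)).trans_lt hrx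
    rw [mem_ball_iff_norm] at hz ⊢
    calc ‖z + ζ • x - z₀‖ = ‖(z - z₀) + ζ • x‖ := by congr 1; abel
      _ ≤ ‖z - z₀‖ + ‖ζ • x‖ := norm_add_le _ _
      _ < 2 * ρ := by linarith
  have hsub : ball z₀ (2 * ρ) ⊆ U := (ball_subset_ball (by linarith)).trans hUball
  have hdiff : ∀ z ∈ ball z₀ ρ, ∀ ζ : ℂ, ‖ζ‖ ≤ r → DifferentiableAt ℂ f (z + ζ • x) :=
    fun z hz ζ hζ => hf.differentiableAt (hU.mem_nhds (hsub (hin z hz ζ hζ)))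
  let c : ℝ → ℂ := fun θ => _root_.deriv (circleMap 0 r) θ * ((circleMap 0 r θ - 0) ^ 2)⁻¹
  have hne : ∀ θ, circleMap 0 r θ ≠ 0 := fun θ => circleMap_ne_center hr.ne'
  have hcc : Continuous c := by
    simp only [c, deriv_circleMap, sub_zero]
    have := continuous_circleMap 0 r
    exact (this.mul continuous_const).mul ((this.pow 2).inv₀ fun θ => pow_ne_zero 2 (hne θ))
  have hnc : ∀ θ, ‖circleMap 0 r θ‖ ≤ r := fun θ => by simp [abs_of_pos hr]
  have hcn : ∀ θ, ‖c θ‖ = r⁻¹ := by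
    intro θ
    simp only [c, deriv_circleMap, sub_zero, norm_mul, norm_inv, norm_pow, norm_circleMap_zero,
      abs_of_pos hr, Complex.norm_I]
    field_simp
  -- Cauchy's formula on the line through `z` in direction `x`: the right side involves only values
  -- of `f`, so it can be differentiated under the integral.
  have hformula : ∀ z ∈ ball z₀ ρ, fderiv ℂ f z x = (2 * Real.pi * Complex.I : ℂ)⁻¹ •
      ∫ θ in (0 : ℝ)..2 * Real.pi, c θ • f (z + circleMap 0 r θ • x) := by
    intro z hz
    have hopen : IsOpen {t : ℂ | z + t • x ∈ U} :=
      hU.preimage (continuous_const.add (continuous_id.smul continuous_const))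
    have h1 := Complex.two_pi_I_inv_smul_circleIntegral_sub_sq_inv_smul_of_differentiable
      (U := {t : ℂ | z + t • x ∈ U}) hopen
      (c := 0) (w₀ := 0) (R := r) (f := fun t => f (z + t • x))
      (fun t ht => hsub (hin z hz t (mem_closedBall_zero_iff.1 ht)))
      (fun t ht => ((hf.differentiableAt
        (hU.mem_nhds ht)).comp_line).differentiableAt.differentiableWithinAt)
      (mem_ball_self hr)
    have h2 := (hdiff z hz 0 (by simpa using hr.le)).comp_line
    rw [h2.deriv] at h1
    simp only [zero_smul, add_zero] at h1
    rw [← h1, circleIntegral]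
    simp only [c, smul_smul]
  have hcontF : ∀ z ∈ ball z₀ ρ, Continuous fun θ => c θ • f (z + circleMap 0 r θ • x) := by
    intro z hz
    refine hcc.smul (hf.continuousOn.comp_continuous ?_ fun θ => hsub (hin z hz _ (hnc θ)))
    exact continuous_const.add ((continuous_circleMap 0 r).smul continuous_const)
  -- Continuity of `fderiv ℂ f` is not yet known; its measurability suffices.
  have hmeas : AEStronglyMeasurable
      (fun θ => c θ • fderiv ℂ f (z₀ + circleMap 0 r θ • x))
      (volume.restrict (Set.uIoc 0 (2 * Real.pi))) := by
    have : ProperSpace (E →L[ℂ] F) := FiniteDimensional.proper ℂ _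
    borelize E (E →L[ℂ] F)
    refine hcc.aestronglyMeasurable.smul (Measurable.aestronglyMeasurable ?_)
    refine (measurable_fderiv ℂ f).comp (Continuous.measurable ?_)
    exact continuous_const.add ((continuous_circleMap 0 r).smul continuous_const)
  have key := intervalIntegral.hasFDerivAt_integral_of_dominated_of_fderiv_le (𝕜 := ℂ)
    (μ := volume) (a := 0) (b := 2 * Real.pi) (x₀ := z₀) (s := ball z₀ ρ)
    (bound := fun _ => r⁻¹ * C)
    (F := fun z θ => c θ • f (z + circleMap 0 r θ • x))
    (F' := fun z θ => c θ • fderiv ℂ f (z + circleMap 0 r θ • x))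
    (ball_mem_nhds z₀ hρ)
    (by filter_upwards [ball_mem_nhds z₀ hρ] with z hz using
          (hcontF z hz).aestronglyMeasurable)
    ((hcontF z₀ (mem_ball_self hρ)).intervalIntegrable _ _)
    hmeas
    (Eventually.of_forall fun θ _ z hz => by
      rw [norm_smul, hcn]
      gcongr
      exact hC _ (hin z hz _ (hnc θ)))
    intervalIntegrable_const
    (Eventually.of_forall fun θ _ z hz => by
      have := (hdiff z hz _ (hnc θ)).hasFDerivAt.comp z
        ((hasFDerivAt_id z).add_const (circleMap 0 r θ • x))
      exact this.const_smul (c θ))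
  refine (key.differentiableAt.const_smul (2 * Real.pi * Complex.I : ℂ)⁻¹).congr_of_eventuallyEq ?_
  filter_upwards [ball_mem_nhds z₀ hρ] with z hz using hformula z hz

/-- A holomorphic function on `E \ {0}` that is homogeneous of degree one is additive. -/
theorem map_add_of_homogeneous [CompleteSpace F] {f : E → F} (hf : DifferentiableOn ℂ f {0}ᶜ)
    (hc : ∀ z, z ≠ 0 → ∀ c : ℂ, c ≠ 0 → f (c • z) = c • f z) {z w : E}
    (hzw : LinearIndependent ℂ ![z, w]) : f (z + w) = f z + f w := by
  have hne : ∀ t : ℂ, z + t • w ≠ 0 := by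
    intro t h
    have := LinearIndependent.pair_iff.1 hzw 1 t (by simpa using h)
    exact one_ne_zero this.1
  have hw : w ≠ 0 := hzw.ne_zero 1
  have hg : Differentiable ℂ fun t : ℂ => f (z + t • w) := fun t =>
    ((hf.differentiableAt (isOpen_compl_singleton.mem_nhds (hne t))).comp_line).differentiableAt
  -- The difference quotient in `t` is entire. By homogeneity it tends to `f w` at infinity, so by
  -- Liouville it equals `f w` everywhere, in particular at `t = 1`.
  have hd : Differentiable ℂ (dslope (fun t : ℂ => f (z + t • w)) 0) :=
    differentiableOn_univ.1 ((Complex.differentiableOn_dslope univ_mem).2 hg.differentiableOn)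
  have hlim : Tendsto (fun t : ℂ => f (t⁻¹ • z + w) - t⁻¹ • f z) (Bornology.cobounded ℂ)
      (𝓝 (f w)) := by
    have hinv : Tendsto (fun t : ℂ => t⁻¹) (Bornology.cobounded ℂ) (𝓝 0) := tendsto_inv₀_cobounded
    have h1 : Tendsto (fun t : ℂ => t⁻¹ • z + w) (Bornology.cobounded ℂ) (𝓝 w) := by
      simpa using (hinv.smul_const z).add_const w
    have h2 : ContinuousAt f w :=
      (hf.differentiableAt (isOpen_compl_singleton.mem_nhds hw)).continuousAt
    simpa using (h2.tendsto.comp h1).sub (hinv.smul_const (f z))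
  have h1 := hd.apply_eq_of_tendsto_cocompact (c := f w) 1 (by
    rw [← Metric.cobounded_eq_cocompact]
    refine hlim.congr' ?_
    filter_upwards [Bornology.eventually_ne_cobounded (0 : ℂ)] with t ht
    have h2 : t⁻¹ • z + w = t⁻¹ • (z + t • w) := by rw [smul_add, inv_smul_smul₀ ht]
    rw [dslope_of_ne _ ht, slope_def_module, h2, hc _ (hne t) _ (inv_ne_zero ht)]
    simp [smul_sub])
  rw [dslope_of_ne _ one_ne_zero, slope_def_module] at h1
  simp only [sub_zero, inv_one, one_smul, zero_smul, add_zero] at h1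
  rw [← h1]; abel

/-- A holomorphic function on `E \ {0}` that is homogeneous of degree one is linear. -/
theorem exists_linearMap_of_homogeneous [CompleteSpace F] {f : E → F}
    (hf : DifferentiableOn ℂ f {0}ᶜ)
    (hc : ∀ z, z ≠ 0 → ∀ c : ℂ, c ≠ 0 → f (c • z) = c • f z) :
    ∃ T : E →ₗ[ℂ] F, ∀ z, z ≠ 0 → f z = T z := by
  classical
  let g : E → F := fun z => if z = 0 then 0 else f z
  have hg0 : g 0 = 0 := if_pos rfl
  have hg : ∀ z, z ≠ 0 → g z = f z := fun z hz => if_neg hz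
  have hsmul : ∀ (c : ℂ) (z : E), g (c • z) = c • g z := by
    intro c z
    rcases eq_or_ne c 0 with rfl | hc0
    · simp [hg0]
    rcases eq_or_ne z 0 with rfl | hz
    · simp [hg0]
    rw [hg _ (smul_ne_zero hc0 hz), hg z hz, hc z hz c hc0]
  refine ⟨⟨⟨g, fun z w => ?_⟩, hsmul⟩, fun z hz => (hg z hz).symm⟩
  by_cases hzw : LinearIndependent ℂ ![z, w]
  · have h : z + w ≠ 0 := fun h =>
      one_ne_zero (LinearIndependent.pair_iff.1 hzw 1 1 (by simpa using h)).1
    rw [hg _ h, hg z (hzw.ne_zero 0), hg w (hzw.ne_zero 1), map_add_of_homogeneous hf hc hzw]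
  · rcases eq_or_ne z 0 with rfl | hz
    · simp [hg0]
    rw [LinearIndependent.pair_iff' hz] at hzw
    push Not at hzw
    obtain ⟨a, rfl⟩ := hzw
    have : z + a • z = (1 + a) • z := by rw [add_smul, one_smul]
    rw [this, hsmul, hsmul, add_smul, one_smul]

/-- Identity theorem along a segment. -/
theorem eq_zero_of_eventually_eq_zero_of_segment_subset [CompleteSpace F] {f : E → F} {U : Set E}
    (hU : IsOpen U) (hf : DifferentiableOn ℂ f U) {y z : E}
    (hseg : ∀ t : ℝ, t ∈ Set.Icc (0 : ℝ) 1 → y + (t : ℂ) • (z - y) ∈ U)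
    (h0 : ∀ᶠ t : ℂ in 𝓝 0, f (y + t • (z - y)) = 0) : f z = 0 := by
  have hopen : IsOpen {t : ℂ | y + t • (z - y) ∈ U} :=
    hU.preimage (continuous_const.add (continuous_id.smul continuous_const))
  have hd : DifferentiableOn ℂ (fun t : ℂ => f (y + t • (z - y)))
      {t : ℂ | y + t • (z - y) ∈ U} := fun t ht =>
    ((hf.differentiableAt (hU.mem_nhds ht)).comp_line).differentiableAt.differentiableWithinAt
  have han : AnalyticOnNhd ℂ (fun t : ℂ => f (y + t • (z - y)))
      ((fun t : ℝ => (t : ℂ)) '' Set.Icc (0 : ℝ) 1) := by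
    rintro _ ⟨t, ht, rfl⟩
    exact hd.analyticAt (hopen.mem_nhds (hseg t ht))
  have hpre : IsPreconnected ((fun t : ℝ => (t : ℂ)) '' Set.Icc (0 : ℝ) 1) :=
    isPreconnected_Icc.image _ Complex.continuous_ofReal.continuousOn
  have := han.eqOn_zero_of_preconnected_of_eventuallyEq_zero hpre
    (Set.mem_image_of_mem _ (Set.left_mem_Icc.2 zero_le_one)) (by simp only [Complex.ofReal_zero]; exact h0)
    (Set.mem_image_of_mem _ (Set.right_mem_Icc.2 zero_le_one))
  simpa using this

end SeveralComplexVariables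

/-! ### Kernels of alternating forms. -/

namespace AlternatingMap

open Module Function

variable {V : Type*} [AddCommGroup V] [Module ℂ V] {k : ℕ}

/-- The kernel of an alternating form: the vectors whose contraction with the form vanishes. -/
def kernel (η : V [⋀^Fin k]→ₗ[ℂ] ℂ) : Submodule ℂ V where
  carrier := {v | ∀ (x : Fin k → V) (i : Fin k), η (update x i v) = 0}
  add_mem' {u v} hu hv x i := by rw [η.map_update_add, hu, hv, add_zero]
  zero_mem' x i := η.map_update_zero x i
  smul_mem' c v hv x i := by rw [η.map_update_smul, hv, smul_zero]

theorem mem_kernel {η : V [⋀^Fin k]→ₗ[ℂ] ℂ} {v : V} :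
    v ∈ η.kernel ↔ ∀ (x : Fin k → V) (i : Fin k), η (update x i v) = 0 := Iff.rfl

theorem map_eq_zero_of_mem_kernel {η : V [⋀^Fin k]→ₗ[ℂ] ℂ} {x : Fin k → V} {i : Fin k}
    (h : x i ∈ η.kernel) : η x = 0 := by
  simpa using h x i

/-- All terms but the `i`-th repeat an entry. This reads off coefficients, as in Cramer's rule. -/
theorem map_update_sum_smul (η : V [⋀^Fin k]→ₗ[ℂ] ℂ) (e : Fin k → V) (c : Fin k → ℂ) (i : Fin k) :
    η (update e i (∑ j, c j • e j)) = c i * η e := by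
  rw [η.map_update_sum, Finset.sum_eq_single i]
  · simp [η.map_update_smul]
  · intro j _ hj
    rw [η.map_update_smul, η.map_update_self _ hj.symm, smul_zero]
  · simp

theorem eq_zero_of_sum_smul_mem_kernel {η : V [⋀^Fin k]→ₗ[ℂ] ℂ} {e : Fin k → V} (he : η e ≠ 0)
    {c : Fin k → ℂ} (hc : ∑ j, c j • e j ∈ η.kernel) (i : Fin k) : c i = 0 := by
  have := hc e i
  rw [map_update_sum_smul] at this
  exact (mul_eq_zero.1 this).resolve_right he

theorem linearIndependent_of_ne_zero {η : V [⋀^Fin k]→ₗ[ℂ] ℂ} {e : Fin k → V} (he : η e ≠ 0) :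
    LinearIndependent ℂ e :=
  Fintype.linearIndependent_iff.2 fun _ hc i =>
    eq_zero_of_sum_smul_mem_kernel he (hc ▸ η.kernel.zero_mem) i

theorem disjoint_span_kernel {η : V [⋀^Fin k]→ₗ[ℂ] ℂ} {e : Fin k → V} (he : η e ≠ 0) :
    Disjoint (Submodule.span ℂ (Set.range e)) η.kernel := by
  rw [Submodule.disjoint_def]
  intro v hv hk
  obtain ⟨c, rfl⟩ := (Submodule.mem_span_range_iff_exists_fun ℂ).1 hv
  exact Finset.sum_eq_zero fun i _ => by rw [eq_zero_of_sum_smul_mem_kernel he hk i, zero_smul]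

variable [FiniteDimensional ℂ V]

/-- A frame on which `η` does not vanish spans a `k`-dimensional space that meets the kernel
trivially. -/
theorem finrank_kernel_add_le {η : V [⋀^Fin k]→ₗ[ℂ] ℂ} (hη : η ≠ 0) :
    finrank ℂ η.kernel + k ≤ finrank ℂ V := by
  obtain ⟨e, he⟩ : ∃ e, η e ≠ 0 := by
    by_contra! h
    exact hη (AlternatingMap.ext h)
  have h1 := Submodule.finrank_add_finrank_le_of_disjoint (disjoint_span_kernel he)
  rw [finrank_span_eq_card (linearIndependent_of_ne_zero he), Fintype.card_fin] at h1
  omega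

theorem isCompl_span_kernel {η : V [⋀^Fin k]→ₗ[ℂ] ℂ} {e : Fin k → V} (he : η e ≠ 0)
    (hdim : finrank ℂ η.kernel + k = finrank ℂ V) :
    IsCompl (Submodule.span ℂ (Set.range e)) η.kernel := by
  refine ⟨disjoint_span_kernel he, codisjoint_iff.2 ?_⟩
  refine Submodule.eq_top_of_disjoint _ _ ?_ (disjoint_span_kernel he)
  rw [finrank_span_eq_card (linearIndependent_of_ne_zero he), Fintype.card_fin]
  omega

/-- A form whose kernel has complementary dimension to its degree detects its kernel on any frame
on which it does not vanish. -/
theorem mem_kernel_of_forall_update {η : V [⋀^Fin k]→ₗ[ℂ] ℂ} {e : Fin k → V} (he : η e ≠ 0)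
    (hdim : finrank ℂ η.kernel + k = finrank ℂ V) {v : V} (hv : ∀ i, η (update e i v) = 0) :
    v ∈ η.kernel := by
  obtain ⟨u, hu, w, hw, rfl⟩ := Submodule.mem_sup.1
    (((isCompl_span_kernel he hdim).sup_eq_top).symm ▸ Submodule.mem_top : v ∈ _ ⊔ η.kernel)
  obtain ⟨c, rfl⟩ := (Submodule.mem_span_range_iff_exists_fun ℂ).1 hu
  have hc : ∀ i, c i = 0 := fun i => by
    have := hv i
    rw [η.map_update_add, hw e i, add_zero, map_update_sum_smul] at this
    exact (mul_eq_zero.1 this).resolve_right he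
  simpa [hc] using hw

omit [FiniteDimensional ℂ V] in
theorem map_eq_of_sub_mem_kernel {η : V [⋀^Fin k]→ₗ[ℂ] ℂ} {x y : Fin k → V}
    (h : ∀ i, x i - y i ∈ η.kernel) : η x = η y := by
  -- The entries are exchanged one position at a time.
  have : ∀ s : Finset (Fin k), η (s.piecewise x y) = η y := by
    intro s
    induction s using Finset.induction_on with
    | empty => simp
    | insert i s hi ih =>
      rw [Finset.piecewise_insert, ← ih, ← sub_eq_zero, ← sub_add_cancel (x i) (y i),
        η.map_update_add, h i, zero_add]
      have : update (s.piecewise x y) i (y i) = s.piecewise x y := by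
        conv_rhs => rw [← update_eq_self i (s.piecewise x y)]
        simp [hi]
      rw [this, sub_self]
  simpa using this Finset.univ

/-- The forms with a given kernel of complementary dimension to their degree are proportional. -/
theorem eq_zero_of_kernel_le {η ξ : V [⋀^Fin k]→ₗ[ℂ] ℂ} {e : Fin k → V} (he : η e ≠ 0)
    (hdim : finrank ℂ η.kernel + k = finrank ℂ V) (hle : η.kernel ≤ ξ.kernel) (h0 : ξ e = 0) :
    ξ = 0 := by
  have hcompl := isCompl_span_kernel he hdim
  have hli := linearIndependent_of_ne_zero he
  -- On the span of `e`, of dimension `k`, the form `ξ` has top degree and is determined by its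
  -- value on `e`.
  have h1 : ξ.compLinearMap (Submodule.span ℂ (Set.range e)).subtype = 0 := by
    refine (Basis.span hli).ext_alternating fun v hv => ?_
    have hperm : Bijective v := Finite.injective_iff_bijective.1 hv
    have h2 : (fun i => ((Basis.span hli (v i) : Submodule.span ℂ (Set.range e)) : V)) =
        e ∘ Equiv.ofBijective v hperm := by
      funext i
      simp [Basis.span_apply]
    simp only [compLinearMap_apply, zero_apply]
    change ξ (fun i => ((Basis.span hli (v i) : Submodule.span ℂ (Set.range e)) : V)) = 0
    rw [h2, ξ.map_perm, h0, smul_zero]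
  ext x
  obtain ⟨y, hy⟩ : ∃ y : Fin k → Submodule.span ℂ (Set.range e),
      ∀ i, x i - y i ∈ ξ.kernel := by
    have : ∀ i, ∃ y : Submodule.span ℂ (Set.range e), x i - y ∈ ξ.kernel := by
      intro i
      obtain ⟨u, hu, w, hw, huw⟩ := Submodule.mem_sup.1
        ((hcompl.sup_eq_top).symm ▸ Submodule.mem_top : x i ∈ _ ⊔ η.kernel)
      refine ⟨⟨u, hu⟩, hle ?_⟩
      rw [← huw]
      simpa using hw
    choose y hy using this
    exact ⟨y, hy⟩
  rw [map_eq_of_sub_mem_kernel hy]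
  exact congrArg (fun f => f y) h1

end AlternatingMap

/-! ### Linear families of forms killed by their parameter. -/

namespace LinearMap

open Module Function AlternatingMap

variable {V : Type*} [AddCommGroup V] [Module ℂ V] {k : ℕ} {ω : V →ₗ[ℂ] V [⋀^Fin k]→ₗ[ℂ] ℂ}

/-- Polarisation of `hω`: the parameter behaves like one more alternating argument. -/
theorem apply_update_swap (hω : ∀ z, z ∈ (ω z).kernel) (u v : V) (x : Fin k → V) (i : Fin k) :
    ω u (update x i v) = -ω v (update x i u) := by
  have h := hω (u + v) x i
  simp only [map_add, AlternatingMap.add_apply, AlternatingMap.map_update_add, hω u x i,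
    hω v x i] at h
  linear_combination h

theorem mem_kernel_comm (hω : ∀ z, z ∈ (ω z).kernel) {u v : V} :
    v ∈ (ω u).kernel ↔ u ∈ (ω v).kernel := by
  simp only [mem_kernel]
  constructor <;> intro h x i <;> rw [apply_update_swap hω, h, neg_zero]

theorem mem_kernel_of_apply_eq_zero (hω : ∀ z, z ∈ (ω z).kernel) {u : V} (hu : ω u = 0) (v : V) :
    u ∈ (ω v).kernel := by
  rw [mem_kernel_comm hω, hu]
  exact fun _ _ => rfl

/-- In the kernel of a contraction, two vectors that do not annihilate each other form a frame
together with the contracted vector. -/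
theorem exists_eq_of_mem_kernel [FiniteDimensional ℂ V] (hω : ∀ z, z ∈ (ω z).kernel) {z a b : V}
    (hz : z ≠ 0) (hdim : finrank ℂ (ω z).kernel = 3) (ha : a ∈ (ω z).kernel)
    (hb : b ∈ (ω z).kernel) (hab : b ∉ (ω a).kernel) {w : V} (hw : w ∈ (ω z).kernel) :
    ∃ α β γ : ℂ, w = α • z + β • a + γ • b := by
  have hba : a ∉ (ω b).kernel := fun h => hab ((mem_kernel_comm hω).1 h)
  have hza := (mem_kernel_comm hω).1 ha
  have hzb := (mem_kernel_comm hω).1 hb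
  have hli : LinearIndependent ℂ ![z, a, b] := by
    rw [Fintype.linearIndependent_iff]
    intro c hc
    simp only [Fin.sum_univ_three, Matrix.cons_val_zero, Matrix.cons_val_one,
      Matrix.cons_val_two, Matrix.head_cons, Matrix.tail_cons] at hc
    -- Both `z` and `a` lie in the kernel of `ω a`, while `b` does not; the next coefficient is
    -- treated with `ω b`.
    have h2 : c 2 = 0 := by
      by_contra h
      refine hab (((ω a).kernel.smul_mem_iff h).1 ?_)
      have : c 2 • b = -(c 0 • z + c 1 • a) := by rw [eq_neg_iff_add_eq_zero, ← hc]; abel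
      rw [this]
      exact neg_mem (add_mem (Submodule.smul_mem _ _ hza) (Submodule.smul_mem _ _ (hω a)))
    have h1 : c 1 = 0 := by
      by_contra h
      refine hba (((ω b).kernel.smul_mem_iff h).1 ?_)
      have : c 1 • a = -(c 0 • z + c 2 • b) := by rw [eq_neg_iff_add_eq_zero, ← hc]; abel
      rw [this]
      exact neg_mem (add_mem (Submodule.smul_mem _ _ hzb) (Submodule.smul_mem _ _ (hω b)))
    have h0 : c 0 = 0 := by simpa [h1, h2, hz] using hc
    intro i
    fin_cases i <;> assumption
  have hle : Submodule.span ℂ (Set.range ![z, a, b]) ≤ (ω z).kernel := by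
    rw [Submodule.span_le]
    rintro _ ⟨i, rfl⟩
    fin_cases i
    exacts [hω z, ha, hb]
  have heq := Submodule.eq_of_le_of_finrank_eq hle (by
    rw [finrank_span_eq_card hli, hdim, Fintype.card_fin])
  rw [← heq] at hw
  obtain ⟨c, rfl⟩ := (Submodule.mem_span_range_iff_exists_fun ℂ).1 hw
  exact ⟨c 0, c 1, c 2, by simp [Fin.sum_univ_three]⟩

end LinearMap

/-! ### The dichotomy for the constant form. -/

section Dichotomy

open Module Function AlternatingMap LinearMap

variable {V : Type*} [NormedAddCommGroup V] [NormedSpace ℂ V] [FiniteDimensional ℂ V] {k : ℕ}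
  {ω : V →ₗ[ℂ] V [⋀^Fin k]→ₗ[ℂ] ℂ}

/-- A `(k + 1)`-form on a space of dimension `k + 3`, all of whose generic contractions with a vector
are decomposable, has a kernel of dimension at least two, or it is a symplectic form on a space of
dimension four. -/
theorem two_le_finrank_ker_or_ker_eq_bot (hk : 1 ≤ k) (hV : finrank ℂ V = k + 3)
    (hω : ∀ z, z ∈ (ω z).kernel) {G : Set V} (hG : Dense G) (hG0 : ∀ z ∈ G, ω z ≠ 0)
    (hG3 : ∀ z ∈ G, finrank ℂ (ω z).kernel = 3) :
    2 ≤ finrank ℂ (LinearMap.ker ω) ∨ (k = 1 ∧ LinearMap.ker ω = ⊥) := by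
  obtain ⟨z, hz⟩ := hG.nonempty
  have hz0 : z ≠ 0 := by
    rintro rfl
    exact hG0 0 hz (map_zero ω)
  have hzK : ∀ w ∈ G, finrank ℂ (ω w).kernel + k = finrank ℂ V := fun w hw => by
    rw [hG3 w hw, hV, add_comm]
  by_cases hcase : ∀ a ∈ (ω z).kernel, (ω z).kernel ≤ (ω a).kernel
  · left
    obtain ⟨e, he⟩ : ∃ e, ω z e ≠ 0 := by
      by_contra! h
      exact hG0 z hz (AlternatingMap.ext h)
    -- For `u` in the kernel, `ω u` is a multiple of `ω z`, so its value on `e` decides whether it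
    -- vanishes. One linear condition on a three-dimensional space leaves dimension at least two.
    let l : (ω z).kernel →ₗ[ℂ] ℂ :=
      { toFun := fun u => ω u e
        map_add' := fun u v => by simp
        map_smul' := fun c u => by simp }
    have h1 : ∀ u ∈ LinearMap.ker l, (u : V) ∈ LinearMap.ker ω := fun u hu =>
      LinearMap.mem_ker.2 (eq_zero_of_kernel_le he (hzK z hz) (hcase u u.2) hu)
    have h2 : finrank ℂ (LinearMap.ker l) ≤ finrank ℂ (LinearMap.ker ω) := by
      refine LinearMap.finrank_le_finrank_of_injective
        (f := ((ω z).kernel.subtype.comp (LinearMap.ker l).subtype).codRestrict (LinearMap.ker ω)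
          fun u => h1 u u.2) ?_
      intro u v huv
      have h := congrArg (LinearMap.ker ω).subtype huv
      exact Subtype.ext (Subtype.ext h)
    have h3 := LinearMap.finrank_range_add_finrank_ker l
    have h4 : finrank ℂ (LinearMap.range l) ≤ 1 :=
      (Submodule.finrank_le _).trans (finrank_self ℂ).le
    rw [hG3 z hz] at h3
    omega
  · right
    push Not at hcase
    obtain ⟨a, ha, hle⟩ := hcase
    obtain ⟨b, hb, hab⟩ := SetLike.not_le_iff_exists.1 hle
    have hframe := fun w (hw : w ∈ (ω z).kernel) =>
      exists_eq_of_mem_kernel hω hz0 (hG3 z hz) ha hb hab hw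
    have hba : a ∉ (ω b).kernel := fun h => hab ((mem_kernel_comm hω).1 h)
    constructor
    · by_contra hk1
      obtain ⟨x, i, hx⟩ : ∃ x i, ω a (update x i b) ≠ 0 := by
        simpa [mem_kernel] using hab
      have : Nontrivial (Fin k) := Fin.nontrivial_iff_two_le.2 (by omega)
      -- A second slot exists as `k ≥ 2`. Exchanging the parameter `a` with the entry at `j` gives a
      -- frame `y` containing both `a` and `b` on which some `ω w` does not vanish; this is open in
      -- `w`, so `w` can be taken in `G`.
      obtain ⟨j, hj⟩ := exists_ne i
      set x' := update x i b
      have hy : ω (x' j) (update x' j a) ≠ 0 := by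
        rw [apply_update_swap hω, update_eq_self]
        exact neg_ne_zero.2 hx
      set y := update x' j a with hydef
      have hyj : y j = a := by simp [hydef]
      have hyi : y i = b := by simp [hydef, hj.symm, x']
      obtain ⟨w, hw, hwG⟩ : ∃ w, ω w y ≠ 0 ∧ w ∈ G := by
        let l : V →ₗ[ℂ] ℂ :=
          { toFun := fun u => ω u y
            map_add' := fun u v => by simp
            map_smul' := fun c u => by simp }
        have hopen : IsOpen {w | l w ≠ 0} :=
          isOpen_ne_fun l.continuous_of_finiteDimensional continuous_const
        exact hG.inter_open_nonempty _ hopen ⟨x' j, hy⟩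
      -- Putting `z` into any slot of `y` leaves `a` or `b` in another slot, and both are killed by
      -- `ω z`. Hence `w` lies in the span of `z, a, b`, all of whose forms vanish on `y`.
      have hzw : z ∈ (ω w).kernel := by
        refine mem_kernel_of_forall_update hw (hzK w hwG) fun l => ?_
        rw [apply_update_swap hω, neg_eq_zero]
        rcases eq_or_ne l j with rfl | hl
        · refine map_eq_zero_of_mem_kernel (i := i) ?_
          rwa [update_of_ne hj.symm, hyi]
        · refine map_eq_zero_of_mem_kernel (i := j) ?_
          rwa [update_of_ne hl.symm, hyj]
      obtain ⟨α, β, γ, rfl⟩ := hframe w ((mem_kernel_comm hω).1 hzw)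
      have h1 : ω z y = 0 := map_eq_zero_of_mem_kernel (i := j) (hyj ▸ ha)
      have h2 : ω a y = 0 := map_eq_zero_of_mem_kernel (i := j) (hyj ▸ hω a)
      have h3 : ω b y = 0 := map_eq_zero_of_mem_kernel (i := i) (hyi ▸ hω b)
      simp [h1, h2, h3] at hw
    · rw [eq_bot_iff]
      intro u hu
      rw [LinearMap.mem_ker] at hu
      have huK := fun v => mem_kernel_of_apply_eq_zero hω hu v
      obtain ⟨α, β, γ, rfl⟩ := hframe u (huK z)
      have hβ : β = 0 := by
        by_contra h
        refine hba (((ω b).kernel.smul_mem_iff h).1 ?_)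
        have h1 := sub_mem (sub_mem (huK b) (Submodule.smul_mem _ α ((mem_kernel_comm hω).1 hb)))
          (Submodule.smul_mem _ γ (hω b))
        convert h1 using 1; abel
      have hγ : γ = 0 := by
        by_contra h
        refine hab (((ω a).kernel.smul_mem_iff h).1 ?_)
        have h1 := sub_mem (sub_mem (huK a) (Submodule.smul_mem _ α ((mem_kernel_comm hω).1 ha)))
          (Submodule.smul_mem _ β (hω a))
        convert h1 using 1; abel
      have hα : α = 0 := by
        simpa [hβ, hγ, hG0 z hz] using hu
      simp [hα, hβ, hγ]

/-- If the kernel is at least two-dimensional, then it is two-dimensional, and together with `z` it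
spans the kernel of the contraction with `z`. -/
theorem finrank_ker_eq_two_and_kernel_eq (hV : finrank ℂ V = k + 3)
    (hω : ∀ z, z ∈ (ω z).kernel) (hω0 : ω ≠ 0) (h2 : 2 ≤ finrank ℂ (LinearMap.ker ω)) :
    finrank ℂ (LinearMap.ker ω) = 2 ∧
      ∀ z, ω z ≠ 0 → (ω z).kernel = LinearMap.ker ω ⊔ Submodule.span ℂ {z} := by
  have hlt : ∀ z, ω z ≠ 0 →
      finrank ℂ (LinearMap.ker ω ⊔ Submodule.span ℂ {z} : Submodule ℂ V) =
        finrank ℂ (LinearMap.ker ω) + 1 := by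
    intro z hz
    have hz0 : z ≠ 0 := by
      rintro rfl
      exact hz (map_zero ω)
    have hdisj : Disjoint (LinearMap.ker ω) (Submodule.span ℂ {z}) := by
      rw [Submodule.disjoint_span_singleton' hz0]
      exact hz
    have := Submodule.finrank_sup_add_finrank_inf_eq (LinearMap.ker ω) (Submodule.span ℂ {z})
    rwa [hdisj.eq_bot, finrank_bot, add_zero, finrank_span_singleton hz0] at this
  have hle : ∀ z, LinearMap.ker ω ⊔ Submodule.span ℂ {z} ≤ (ω z).kernel := by
    intro z
    refine sup_le (fun u hu => mem_kernel_of_apply_eq_zero hω hu z) ?_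
    rw [Submodule.span_singleton_le_iff_mem]
    exact hω z
  -- This bound caps `ker ω` at dimension two, since `z` contributes one more dimension.
  have hub : ∀ z, ω z ≠ 0 → finrank ℂ (ω z).kernel ≤ 3 := fun z hz => by
    have := finrank_kernel_add_le hz
    omega
  obtain ⟨z, hz⟩ : ∃ z, ω z ≠ 0 := by
    by_contra! h
    exact hω0 (LinearMap.ext h)
  have heq : finrank ℂ (LinearMap.ker ω) = 2 := by
    have h3 := Submodule.finrank_mono (hle z)
    have h4 := hub z hz
    rw [hlt z hz] at h3
    omega
  refine ⟨heq, fun z hz => (Submodule.eq_of_le_of_finrank_le (hle z) ?_).symm⟩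
  rw [hlt z hz, heq]
  exact hub z hz

end Dichotomy

/-! ### Cones over open sets of projective space. -/

section Cone

variable {n : ℕ}

theorem ne_zero_of_mem_coneOver {U : Opens (CProj n)} {z : Fin (n + 1) → ℂ} (hz : z ∈ coneOver U) :
    z ≠ 0 := hz.1

theorem smul_mem_coneOver {U : Opens (CProj n)} {z : Fin (n + 1) → ℂ} (hz : z ∈ coneOver U) {c : ℂ}
    (hc : c ≠ 0) : c • z ∈ coneOver U := by
  obtain ⟨h0, hz⟩ := hz
  refine ⟨smul_ne_zero hc h0, ?_⟩
  rwa [(Projectivization.mk_eq_mk_iff' ℂ _ _ (smul_ne_zero hc h0) h0).2 ⟨c, rfl⟩]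

theorem mk_mem_iff_mem_coneOver {U : Opens (CProj n)} {z : Fin (n + 1) → ℂ} (hz : z ≠ 0) :
    Projectivization.mk ℂ z hz ∈ U ↔ z ∈ coneOver U := ⟨fun h => ⟨hz, h⟩, fun h => h.2⟩

theorem coneOver_mono {U W : Opens (CProj n)} (h : W ≤ U) : coneOver W ⊆ coneOver U :=
  fun _ hz => ⟨hz.1, h hz.2⟩

theorem le_of_coneOver_subset {U W : Opens (CProj n)} (h : coneOver W ⊆ coneOver U) : W ≤ U := by
  intro p hp
  induction p using Projectivization.ind with
  | h z hz => exact (h ⟨hz, hp⟩).2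

theorem isOpen_coneOver (U : Opens (CProj n)) : IsOpen (coneOver U) := by
  have h1 : IsOpen {v : {v : Fin (n + 1) → ℂ // v ≠ 0} | Projectivization.mk ℂ v.1 v.2 ∈ U} :=
    isOpen_coinduced.1 U.isOpen
  have h2 := (isOpen_compl_singleton (x := (0 : Fin (n + 1) → ℂ))).isOpenMap_subtype_val _ h1
  convert h2 using 1
  ext z
  constructor
  · rintro ⟨hz, h⟩
    exact ⟨⟨z, hz⟩, h, rfl⟩
  · rintro ⟨⟨z, hz⟩, h, rfl⟩
    exact ⟨hz, h⟩

/-- The quotient topology is coinduced, and scaling invariance makes `C` saturated for the quotient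
map. -/
theorem exists_coneOver_eq {C : Set (Fin (n + 1) → ℂ)} (hC : IsOpen C) (h0 : (0 : Fin (n + 1) → ℂ) ∉ C)
    (hsmul : ∀ z ∈ C, ∀ c : ℂ, c ≠ 0 → c • z ∈ C) : ∃ W : Opens (CProj n), coneOver W = C := by
  have hmk : ∀ z (hz : z ≠ 0), (∃ w, ∃ hw : w ≠ 0, w ∈ C ∧
      Projectivization.mk ℂ w hw = Projectivization.mk ℂ z hz) ↔ z ∈ C := by
    intro z hz
    constructor
    · rintro ⟨w, hw, hwC, h⟩
      obtain ⟨c, rfl⟩ := (Projectivization.mk_eq_mk_iff' ℂ _ _ hz hw).1 h.symm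
      exact hsmul w hwC c fun hc => hz (by rw [hc, zero_smul])
    · exact fun h => ⟨z, hz, h, rfl⟩
  refine ⟨⟨{p | ∃ w, ∃ hw : w ≠ 0, w ∈ C ∧ Projectivization.mk ℂ w hw = p}, ?_⟩, ?_⟩
  · refine isOpen_coinduced.2 ?_
    convert hC.preimage (continuous_subtype_val (p := fun v : Fin (n + 1) → ℂ => v ≠ 0)) using 1
    ext ⟨z, hz⟩
    exact hmk z hz
  · ext z
    constructor
    · rintro ⟨hz, h⟩
      exact (hmk z hz).1 h
    · intro hz
      have hz0 : z ≠ 0 := fun h => h0 (h ▸ hz)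
      exact ⟨hz0, (hmk z hz0).2 hz⟩

/-- Every point has arbitrarily small neighbourhoods that are balls in an affine chart. -/
theorem exists_affine_ball_le {U : Opens (CProj n)} {p : CProj n} (hp : p ∈ U) :
    ∃ (i : Fin (n + 1)) (z₁ : Fin (n + 1) → ℂ) (ε : ℝ) (W : Opens (CProj n)), p ∈ W ∧ W ≤ U ∧
      coneOver W = {z | z i ≠ 0 ∧ (z i)⁻¹ • z ∈ Metric.ball z₁ ε} := by
  induction p using Projectivization.ind with
  | h z hz =>
    obtain ⟨i, hi⟩ := Function.ne_iff.1 hz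
    have hi : z i ≠ 0 := hi
    obtain ⟨ε, hε, hball⟩ := Metric.isOpen_iff.1 (isOpen_coneOver U) _
      (smul_mem_coneOver (⟨hz, hp⟩ : z ∈ coneOver U) (inv_ne_zero hi))
    obtain ⟨W, hW⟩ := exists_coneOver_eq
      (C := {w : Fin (n + 1) → ℂ | w i ≠ 0 ∧ (w i)⁻¹ • w ∈ Metric.ball ((z i)⁻¹ • z) ε})
      (by
        have h1 : IsOpen {w : Fin (n + 1) → ℂ | w i ≠ 0} :=
          isOpen_ne_fun (continuous_apply i) continuous_const
        refine ContinuousOn.isOpen_inter_preimage (f := fun w : Fin (n + 1) → ℂ => (w i)⁻¹ • w)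
          ?_ h1 Metric.isOpen_ball
        exact ((continuous_apply i).continuousOn.inv₀ fun w hw => hw).smul continuousOn_id)
      (fun h => h.1 rfl)
      (by
        rintro w ⟨hw, hwb⟩ c hc
        refine ⟨mul_ne_zero hc hw, ?_⟩
        have : ((c • w) i)⁻¹ • c • w = (w i)⁻¹ • w := by
          rw [smul_smul]
          congr 1
          simp only [Pi.smul_apply, smul_eq_mul]
          field_simp
        rwa [this])
    refine ⟨i, (z i)⁻¹ • z, ε, W, ?_, ?_, hW⟩
    · rw [mk_mem_iff_mem_coneOver, hW]
      exact ⟨hi, Metric.mem_ball_self hε⟩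
    · refine le_of_coneOver_subset fun w hw => ?_
      rw [hW] at hw
      have := smul_mem_coneOver (hball hw.2) hw.1
      rwa [smul_inv_smul₀ hw.1] at this

/-- A regular function on a ball in an affine chart that does not vanish identically
does not vanish on an open set. -/
theorem interior_zero_eq_empty {i : Fin (n + 1)} {z₁ : Fin (n + 1) → ℂ} {ε : ℝ}
    {W : Opens (CProj n)} (hW : coneOver W = {z | z i ≠ 0 ∧ (z i)⁻¹ • z ∈ Metric.ball z₁ ε})
    {f : (Fin (n + 1) → ℂ) → ℂ} (hf : IsRegularOn W f) {z₂ : Fin (n + 1) → ℂ}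
    (hz₂ : z₂ ∈ coneOver W) (hfz : f z₂ ≠ 0) : interior {z ∈ coneOver W | f z = 0} = ∅ := by
  by_contra hne
  obtain ⟨y, hy⟩ := Set.nonempty_iff_ne_empty.2 hne
  have hyW : y ∈ coneOver W := (interior_subset hy).1
  have hy' := hW ▸ hyW
  have hz' := hW ▸ hz₂
  have hnorm : ∀ z : Fin (n + 1) → ℂ, z i ≠ 0 → ((z i)⁻¹ • z) i = 1 := fun z hz => by
    simp [hz]
  set y' := (y i)⁻¹ • y
  set z' := (z₂ i)⁻¹ • z₂
  have hyy : y i • y' = y := smul_inv_smul₀ hy'.1 y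
  refine hfz ?_
  rw [← hf.2 z₂ hz₂ _ (inv_ne_zero hz'.1)]
  change f z' = 0
  -- Both points are normalised to have `i`-th coordinate one; the segment between them stays in the
  -- ball. Rescaling by `y i` carries a neighbourhood of `y'` on the line into the zero set around
  -- `y`.
  refine eq_zero_of_eventually_eq_zero_of_segment_subset (y := y') (isOpen_coneOver W) hf.1 ?_ ?_
  · intro t ht
    have h1 : (y' + (t : ℂ) • (z' - y')) i = 1 := by
      have e1 : y' i = 1 := hnorm y hy'.1
      have e2 : z' i = 1 := hnorm z₂ hz'.1
      rw [Pi.add_apply, Pi.smul_apply, Pi.sub_apply, e1, e2, sub_self, smul_zero, add_zero]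
    rw [hW]
    refine ⟨by rw [h1]; exact one_ne_zero, ?_⟩
    rw [h1, inv_one, one_smul]
    have := (convex_ball z₁ ε).add_smul_sub_mem hy'.2 hz'.2 ht
    simpa only [Complex.coe_smul] using this
  · have h1 : Tendsto (fun t : ℂ => y i • (y' + t • (z' - y'))) (𝓝 0) (𝓝 y) := by
      have h2 : Continuous fun t : ℂ => y i • (y' + t • (z' - y')) := by fun_prop
      have := h2.tendsto 0
      simpa only [zero_smul, add_zero, hyy] using this
    filter_upwards [h1 (isOpen_interior.mem_nhds hy)] with t ht
    have h3 := interior_subset ht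
    have h4 := hf.2 _ h3.1 _ (inv_ne_zero hy'.1)
    rw [inv_smul_smul₀ hy'.1] at h4
    rw [h4]
    exact h3.2

end Cone

/-! ### Three-by-three minors. -/

section Minor

open Module Function

variable {V : Type*} [NormedAddCommGroup V] [NormedSpace ℂ V]

/-- Linearly independent vectors are separated by the pull back of the determinant. -/
theorem LinearIndependent.exists_linearMap_det_ne_zero {y : Fin 3 → V}
    (hy : LinearIndependent ℂ y) :
    ∃ P : V →ₗ[ℂ] (Fin 3 → ℂ), ((Pi.basisFun ℂ (Fin 3)).det.compLinearMap P) y ≠ 0 := by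
  obtain ⟨P, hP⟩ := LinearMap.exists_leftInverse_of_injective (Fintype.linearCombination ℂ y)
    (LinearMap.ker_eq_bot.2 hy.fintypeLinearCombination_injective)
  refine ⟨P, ?_⟩
  have : P ∘ y = Pi.basisFun ℂ (Fin 3) := by
    funext j
    have := congrArg (fun T => T (Pi.single j 1)) hP
    simpa using this
  rw [AlternatingMap.compLinearMap_apply]
  change (Pi.basisFun ℂ (Fin 3)).det (P ∘ y) ≠ 0
  rw [this, Basis.det_self]
  exact one_ne_zero

theorem DifferentiableOn.det_comp [FiniteDimensional ℂ V] {S : Set V} {u : Fin 3 → V → V} (P : V →ₗ[ℂ] (Fin 3 → ℂ))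
    (hu : ∀ j, DifferentiableOn ℂ (u j) S) :
    DifferentiableOn ℂ
      (fun z => ((Pi.basisFun ℂ (Fin 3)).det.compLinearMap P) fun j => u j z) S := by
  have h : ∀ i j, DifferentiableOn ℂ (fun z => P (u j z) i) S := by
    intro i j
    exact (((LinearMap.proj i).comp P).toContinuousLinearMap.differentiable.comp_differentiableOn
      (hu j))
  simp only [AlternatingMap.compLinearMap_apply, Basis.det_apply, Matrix.det_apply,
    Basis.toMatrix_apply, Pi.basisFun_repr, Fin.prod_univ_three]
  exact DifferentiableOn.fun_sum fun σ _ =>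
    (((h _ _).fun_mul (h _ _)).fun_mul (h _ _)).const_smul _

end Minor

/-! ### A distribution recovered from its determinant form. -/

namespace HolomorphicDistribution

open Module Function AlternatingMap

variable {n s k : ℕ}

theorem mem_sec_of_eqOn (F : HolomorphicDistribution n s) {U : Opens (CProj n)}
    {v w : (Fin (n + 1) → ℂ) → (Fin (n + 1) → ℂ)} (hv : v ∈ F.sec U)
    (h : Set.EqOn w v (coneOver U)) : w ∈ F.sec U := by
  have hv' := F.homogeneous U v hv
  refine F.glue U w ⟨hv'.1.congr h, fun z hz c hc => ?_⟩ fun p hp => ⟨U, le_rfl, hp, v, hv, h⟩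
  rw [h hz, h (smul_mem_coneOver hz hc), hv'.2 z hz c hc]

theorem sum_mem_sec (F : HolomorphicDistribution n s) {ι : Type*} (S : Finset ι)
    {U : Opens (CProj n)} {v : ι → (Fin (n + 1) → ℂ) → (Fin (n + 1) → ℂ)}
    (hv : ∀ i, v i ∈ F.sec U) : (fun z => ∑ i ∈ S, v i z) ∈ F.sec U := by
  classical
  induction S using Finset.induction_on with
  | empty =>
    have h := F.smul_mem U (fun _ => 0) ⟨differentiableOn_const 0, fun _ _ _ _ => rfl⟩ _
      (F.radial_mem U)
    simpa using h
  | insert i S hi ih =>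
    have h := F.add_mem U _ (hv i) _ ih
    refine F.mem_sec_of_eqOn h fun z _ => ?_
    simp [Finset.sum_insert hi]

/-- The values at `z` of the sections near `z`. -/
def valuesAt (F : HolomorphicDistribution n s) (z : Fin (n + 1) → ℂ) : Set (Fin (n + 1) → ℂ) :=
  {x | ∃ U : Opens (CProj n), z ∈ coneOver U ∧ ∃ v ∈ F.sec U, v z = x}

/-- If a linear family of `k`-forms annihilates `F` and is generically nonzero, in the maximal
degree `k = n - 2`, then `F` consists of all the fields that are annihilated. -/
theorem mem_sec_of_forall_mem_kernel (F : HolomorphicDistribution n 2) (hn : n = k + 2)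
    {ω : (Fin (n + 1) → ℂ) →ₗ[ℂ] (Fin (n + 1) → ℂ) [⋀^Fin k]→ₗ[ℂ] ℂ}
    (hsec : ∀ U, ∀ v ∈ F.sec U, ∀ z ∈ coneOver U, v z ∈ (ω z).kernel)
    (hdense : Dense {z | ω z ≠ 0}) {U : Opens (CProj n)}
    {v : (Fin (n + 1) → ℂ) → (Fin (n + 1) → ℂ)} (hv : IsHomogeneousField U v)
    (hvk : ∀ z ∈ coneOver U, v z ∈ (ω z).kernel) : v ∈ F.sec U := by
  refine F.glue U v hv fun p hp => ?_
  obtain ⟨U₀, hp₀, r, g, hg, hgen⟩ := F.coherent p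
  obtain ⟨i, z₁, ε, W, hpW, hWle, hW⟩ := exists_affine_ball_le (U := U ⊓ U₀) ⟨hp, hp₀⟩
  have hWU : W ≤ U := hWle.trans inf_le_left
  have hWU₀ : W ≤ U₀ := hWle.trans inf_le_right
  have hWi : ∀ z ∈ coneOver W, z i ≠ 0 := fun z hz => (hW ▸ hz : z ∈ {z | _ ∧ _}).1
  refine ⟨W, hWU, hpW, v, ?_, fun _ _ => rfl⟩
  have hvW : IsHomogeneousField W v :=
    ⟨hv.1.mono (coneOver_mono hWU), fun z hz => hv.2 z (coneOver_mono hWU hz)⟩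
  have hgW : ∀ j, g j ∈ F.sec W := fun j => F.restrict U₀ W hWU₀ _ (hg j)
  have hgh : ∀ j, IsHomogeneousField W (g j) := fun j => F.homogeneous W _ (hgW j)
  -- three generators that are independent at some point
  obtain ⟨z₂, hz₂, hrank⟩ : ∃ z ∈ coneOver W,
      finrank ℂ (Submodule.span ℂ (F.valuesAt z)) = 2 + 1 := by
    have hne : (coneOver W).Nonempty := by
      induction p using Projectivization.ind with
      | h z hz => exact ⟨z, hz, hpW⟩
    exact F.generic_rank.inter_open_nonempty _ (isOpen_coneOver W) hne
  obtain ⟨σ, hσ⟩ : ∃ σ : Fin 3 → Fin r, LinearIndependent ℂ fun j => g (σ j) z₂ := by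
    have hspan : Submodule.span ℂ (F.valuesAt z₂) ≤
        Submodule.span ℂ (Set.range fun j => g j z₂) := by
      rw [Submodule.span_le]
      rintro _ ⟨U₁, hz₁, w, hw, rfl⟩
      have hq : Projectivization.mk ℂ z₂ hz₂.1 ∈ U₁ ⊓ W := ⟨hz₁.2, hz₂.2⟩
      obtain ⟨W', hW', hq', f, -, hf⟩ := hgen (U₁ ⊓ W) (inf_le_right.trans hWU₀) w
        (F.restrict U₁ _ inf_le_left w hw) _ hq
      rw [SetLike.mem_coe, hf z₂ ⟨hz₂.1, hq'⟩]
      exact Submodule.sum_mem _ fun j _ =>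
        Submodule.smul_mem _ _ (Submodule.subset_span (Set.mem_range_self j))
    have hle := Submodule.finrank_mono hspan
    rw [hrank] at hle
    obtain ⟨y, hy, -, hyli⟩ :=
      Submodule.exists_fun_fin_finrank_span_eq ℂ (Set.range fun j => g j z₂)
    choose τ hτ using hy
    refine ⟨fun j => τ (Fin.castLE hle j), ?_⟩
    have := hyli.comp (Fin.castLE hle) (Fin.castLE_injective hle)
    have h : (fun j => g (τ (Fin.castLE hle j)) z₂) = y ∘ Fin.castLE hle := funext fun j => hτ _
    exact h ▸ this
  obtain ⟨P, hP⟩ := hσ.exists_linearMap_det_ne_zero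
  set D := (Pi.basisFun ℂ (Fin 3)).det.compLinearMap P
  let G : (Fin (n + 1) → ℂ) → Fin 3 → Fin (n + 1) → ℂ := fun z j => g (σ j) z
  -- the regular functions given by homogeneous fields
  have hreg : ∀ u : Fin 3 → (Fin (n + 1) → ℂ) → (Fin (n + 1) → ℂ),
      (∀ j, IsHomogeneousField W (u j)) →
      IsRegularOn W fun z => (z i)⁻¹ ^ 3 * D fun j => u j z := by
    intro u hu
    refine ⟨?_, fun z hz c hc => ?_⟩
    · have h1 : DifferentiableOn ℂ (fun z : Fin (n + 1) → ℂ => (z i)⁻¹ ^ 3) (coneOver W) :=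
        ((differentiable_apply i).differentiableOn.fun_inv hWi).fun_pow 3
      exact h1.fun_mul (DifferentiableOn.det_comp P fun j => (hu j).1)
    -- `D` is cubic in fields of degree one; the factor `(z i)⁻¹ ^ 3` brings the degree to zero.
    · have h1 : (fun j => u j (c • z)) = fun j => c • u j z :=
        funext fun j => (hu j).2 z hz c hc
      have h2 := D.toMultilinearMap.map_smul_univ (fun _ => c) fun j => u j z
      simp only [coe_multilinearMap, Finset.prod_const, Finset.card_univ, Fintype.card_fin] at h2
      have hzi := hWi z hz
      change ((c • z) i)⁻¹ ^ 3 * D (fun j => u j (c • z)) = (z i)⁻¹ ^ 3 * D fun j => u j z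
      rw [h1, h2, Pi.smul_apply, smul_eq_mul, smul_eq_mul]
      field_simp
  have hf := hreg (fun j => g (σ j)) fun j => hgh _
  have hc : ∀ j, IsRegularOn W fun z => (z i)⁻¹ ^ 3 * D (update (G z) j (v z)) := by
    intro j
    have h := hreg (update (fun l => g (σ l)) j v) fun l => by
      rcases eq_or_ne l j with rfl | hl
      · simpa using hvW
      · simpa [hl] using hgh _
    have heq : ∀ z, (fun l => update (fun l => g (σ l)) j v l z) = update (G z) j (v z) := by
      intro z
      funext l
      rcases eq_or_ne l j with rfl | hl
      · simp
      · simp [hl, G]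
    simpa only [heq] using h
  have hint := interior_zero_eq_empty hW hf hz₂
    (mul_ne_zero (pow_ne_zero 3 (inv_ne_zero (hWi z₂ hz₂))) hP)
  -- Cramer's rule
  have hcramer : Set.EqOn
      (fun z => ((z i)⁻¹ ^ 3 * D (G z)) • v z)
      (fun z => ∑ j, ((z i)⁻¹ ^ 3 * D (update (G z) j (v z))) • g (σ j) z) (coneOver W) := by
    -- Here the three generators are independent and span the kernel of `ω z`, whose dimension is at
    -- most three.
    have hgood : ∀ z ∈ coneOver W, D (G z) ≠ 0 → ω z ≠ 0 →
        ((z i)⁻¹ ^ 3 * D (G z)) • v z =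
          ∑ j, ((z i)⁻¹ ^ 3 * D (update (G z) j (v z))) • g (σ j) z := by
      intro z hz hD hω
      have hle : Submodule.span ℂ (Set.range (G z)) ≤ (ω z).kernel := by
        rw [Submodule.span_le]
        rintro _ ⟨j, rfl⟩
        exact hsec W _ (hgW _) z hz
      have heq := Submodule.eq_of_le_of_finrank_le hle (by
        rw [finrank_span_eq_card (linearIndependent_of_ne_zero hD), Fintype.card_fin]
        have := finrank_kernel_add_le hω
        rw [finrank_fin_fun] at this
        omega)
      have hvz := hvk z (coneOver_mono hWU hz)
      rw [← heq] at hvz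
      obtain ⟨a, ha⟩ := (Submodule.mem_span_range_iff_exists_fun ℂ).1 hvz
      simp only [← ha, map_update_sum_smul, Finset.smul_sum, smul_smul]
      exact Finset.sum_congr rfl fun j _ => by
        congr 1
        ring
    intro z hz
    by_contra hne
    -- Failure of the identity is an open condition. The minor is not identically zero on a nonempty
    -- open set, so a failure would also occur at a point covered by `hgood`.
    have hcont : ContinuousOn (fun z => ((z i)⁻¹ ^ 3 * D (G z)) • v z -
        ∑ j, ((z i)⁻¹ ^ 3 * D (update (G z) j (v z))) • g (σ j) z) (coneOver W) :=
      (hf.1.continuousOn.smul hvW.1.continuousOn).sub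
        (continuousOn_finsetSum _ fun j _ => (hc j).1.continuousOn.smul (hgh (σ j)).1.continuousOn)
    have hO := hcont.isOpen_inter_preimage (isOpen_coneOver W)
      (isOpen_compl_singleton (x := (0 : Fin (n + 1) → ℂ)))
    have hO2 := hO.inter (hf.1.continuousOn.isOpen_inter_preimage (isOpen_coneOver W)
      (isOpen_compl_singleton (x := (0 : ℂ))))
    obtain ⟨y, hy, hyω⟩ := hdense.inter_open_nonempty _ hO2 (by
      by_contra hempty
      have hsub : z ∈ interior {z ∈ coneOver W | (z i)⁻¹ ^ 3 * D (G z) = 0} := by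
        rw [mem_interior]
        refine ⟨_, fun y hy => ⟨hy.1, ?_⟩, hO, hz, sub_ne_zero.2 hne⟩
        by_contra h
        exact hempty ⟨y, hy, hy.1, h⟩
      exact Set.notMem_empty z (hint ▸ hsub))
    exact hy.1.2 (sub_eq_zero.2 (hgood y hy.1.1 (fun h => hy.2.2 (by simp [G, h])) hyω))
  refine F.saturated W _ hf hint v hvW (F.mem_sec_of_eqOn ?_ hcramer)
  exact F.sum_mem_sec Finset.univ fun j => F.smul_mem W _ (hc j) _ (hgW (σ j))

/-- A determinant form of a distribution of degree zero is linear. -/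
theorem exists_linear_form_of_hasDegree_zero (F : HolomorphicDistribution n 2)
    (hF : F.HasDegree 0) :
    ∃ ω : (Fin (n + 1) → ℂ) →ₗ[ℂ] (Fin (n + 1) → ℂ) [⋀^Fin (n - 2)]→ₗ[ℂ] ℂ,
      (∀ z, z ∈ (ω z).kernel) ∧ Dense {z | ω z ≠ 0} ∧
      ∀ U, ∀ v ∈ F.sec U, ∀ z ∈ coneOver U, v z ∈ (ω z).kernel := by
  obtain ⟨η, hη⟩ := hF
  obtain ⟨T, hT⟩ := exists_linearMap_of_homogeneous hη.holomorphic fun z hz c hc => by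
    have h := hη.homogeneous z hz c hc
    have h1 : (0 + ((n - 2 : ℕ) : ℤ) + 1 - ((n - 2 : ℕ) : ℤ)) = 1 := by ring
    rwa [h1, zpow_one] at h
  refine ⟨ContinuousAlternatingMap.toAlternatingMapLinear.comp T, fun z x i => ?_, ?_, ?_⟩
  · rcases eq_or_ne z 0 with rfl | hz
    · simp
    · change T z (update x i z) = 0
      rw [← hT z hz]
      exact hη.radial z hz _ i (by simp)
  · refine Dense.of_closure ((dense_compl_singleton (0 : Fin (n + 1) → ℂ)).mono fun p hp => ?_)
    rw [mem_closure_iff_frequently]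
    -- With `f = 0` the codimension condition says that the zero set of the form contains no open
    -- set.
    have h := hη.codim_two p hp (fun _ => 0) analyticAt_const rfl
    have h2 : ∀ᶠ z in 𝓝 p, z ≠ 0 := isOpen_ne.mem_nhds hp
    refine (h.and_eventually h2).mono fun z hz h0 => hz.1.2 ?_
    rw [hT z hz.2]
    ext x
    exact congrArg (fun f => f x) h0
  · intro U v hv z hz x i
    change T z (update x i (v z)) = 0
    rw [← hT z (ne_zero_of_mem_coneOver hz)]
    exact hη.annihilates U v hv z hz _ i (by simp)

end HolomorphicDistribution

/-! ### Lie brackets of homogeneous fields. -/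

section LieBracket

variable {n : ℕ} {U : Opens (CProj n)} {v w : (Fin (n + 1) → ℂ) → (Fin (n + 1) → ℂ)}

theorem IsHomogeneousField.differentiableAt (hv : IsHomogeneousField U v) {z : Fin (n + 1) → ℂ}
    (hz : z ∈ coneOver U) : DifferentiableAt ℂ v z :=
  hv.1.differentiableAt ((isOpen_coneOver U).mem_nhds hz)

theorem IsHomogeneousField.fderiv_smul (hv : IsHomogeneousField U v) {z : Fin (n + 1) → ℂ}
    (hz : z ∈ coneOver U) {c : ℂ} (hc : c ≠ 0) : fderiv ℂ v (c • z) = fderiv ℂ v z := by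
  have h1 : HasFDerivAt v (fderiv ℂ v z) (c⁻¹ • c • z) := by
    rw [inv_smul_smul₀ hc]
    exact (hv.differentiableAt hz).hasFDerivAt
  have h2 := (h1.comp (c • z) ((hasFDerivAt_id (c • z)).const_smul c⁻¹)).const_smul c
  have h3 : (fun y => c • v (c⁻¹ • y)) =ᶠ[𝓝 (c • z)] v := by
    filter_upwards [(isOpen_coneOver U).mem_nhds (smul_mem_coneOver hz hc)] with y hy
    rw [hv.2 y hy _ (inv_ne_zero hc), smul_inv_smul₀ hc]
  refine (h3.hasFDerivAt_iff.1 h2).fderiv.trans ?_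
  ext1 y
  simp [smul_smul, hc]

theorem IsHomogeneousField.differentiableOn_fderiv_apply (hv : IsHomogeneousField U v)
    (hw : IsHomogeneousField U w) :
    DifferentiableOn ℂ (fun z => fderiv ℂ w z (v z)) (coneOver U) := by
  -- Expanding `v z` in the standard basis reduces to derivatives along constant vectors.
  have h : (fun z => fderiv ℂ w z (v z)) =
      fun z => ∑ i, v z i • fderiv ℂ w z (fun j => if i = j then 1 else 0) := by
    funext z
    exact LinearMap.pi_apply_eq_sum_univ (fderiv ℂ w z).toLinearMap (v z)
  rw [h]
  exact DifferentiableOn.fun_sum fun i _ => (differentiableOn_pi.1 hv.1 i).fun_smul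
    (hw.1.fderiv_apply_const (isOpen_coneOver U) _)

theorem IsHomogeneousField.lieBracket (hv : IsHomogeneousField U v)
    (hw : IsHomogeneousField U w) : IsHomogeneousField U (VectorField.lieBracket ℂ v w) := by
  refine ⟨(hv.differentiableOn_fderiv_apply hw).sub (hw.differentiableOn_fderiv_apply hv),
    fun z hz c hc => ?_⟩
  simp only [VectorField.lieBracket, hv.fderiv_smul hz hc, hw.fderiv_smul hz hc, hv.2 z hz c hc,
    hw.2 z hz c hc, map_smul, smul_sub]

variable {m : ℕ} {L : (Fin (n + 1) → ℂ) →ₗ[ℂ] (Fin (m + 1) → ℂ)}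

/-- A field that is tangent to the fibres of a linear projection is projected to a multiple of the
radial field, with a holomorphic factor. -/
theorem IsHomogeneousField.exists_fderiv_of_tangent (hv : IsHomogeneousField U v)
    (hvL : ∀ z ∈ coneOver U, L z ≠ 0 → L (v z) ∈ Submodule.span ℂ {L z}) {z : Fin (n + 1) → ℂ}
    (hz : z ∈ coneOver U) (hLz : L z ≠ 0) :
    ∃ (c : ℂ) (ℓ : (Fin (n + 1) → ℂ) → ℂ), L (v z) = c • L z ∧
      ∀ y, L (fderiv ℂ v z y) = c • L y + ℓ y • L z := by
  obtain ⟨j, hj⟩ := Function.ne_iff.1 hLz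
  replace hj : L z j ≠ 0 := hj
  let L' : (Fin (n + 1) → ℂ) →L[ℂ] (Fin (m + 1) → ℂ) := L.toContinuousLinearMap
  -- A quotient of coordinates makes the multiplier differentiable, so that `L (v y) = c y • L y`
  -- can be differentiated.
  let c : (Fin (n + 1) → ℂ) → ℂ := fun y => L' (v y) j / L' y j
  have hL'v : HasFDerivAt (fun y => L' (v y)) (L'.comp (fderiv ℂ v z)) z :=
    L'.hasFDerivAt.comp z (hv.differentiableAt hz).hasFDerivAt
  have hnum : DifferentiableAt ℂ (fun y => L' (v y) j) z :=
    differentiableAt_pi.1 hL'v.differentiableAt j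
  have hden : DifferentiableAt ℂ (fun y => L' y j) z :=
    differentiableAt_pi.1 L'.differentiableAt j
  have hc : DifferentiableAt ℂ c z := by
    simpa only [c, div_eq_mul_inv] using hnum.fun_mul (hden.fun_inv hj)
  have heq : (fun y => L' (v y)) =ᶠ[𝓝 z] fun y => c y • L' y := by
    have hj' : ∀ᶠ y in 𝓝 z, L' y j ≠ 0 :=
      (((continuous_apply j).comp L'.continuous).continuousAt).eventually_ne hj
    filter_upwards [(isOpen_coneOver U).mem_nhds hz, hj'] with y hy hyj
    have hy0 : L y ≠ 0 := fun h => hyj (congrFun h j)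
    obtain ⟨a, ha⟩ := Submodule.mem_span_singleton.1 (hvL y hy hy0)
    have ha' : L' (v y) = a • L' y := ha.symm
    have : c y = a := by
      simp only [c, ha', Pi.smul_apply, smul_eq_mul]
      field_simp
    rw [this, ha']
  have hder := (heq.hasFDerivAt_iff.1 hL'v).unique (hc.hasFDerivAt.smul L'.hasFDerivAt)
  refine ⟨c z, fderiv ℂ c z, heq.self_of_nhds, fun y => ?_⟩
  have := congrArg (fun T => T y) hder
  simpa [L'] using this

/-- The products of the two multipliers cancel in the bracket, leaving a multiple of `L z`. -/
theorem lieBracket_mem_of_tangent (hv : IsHomogeneousField U v) (hw : IsHomogeneousField U w)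
    (hvL : ∀ z ∈ coneOver U, L z ≠ 0 → L (v z) ∈ Submodule.span ℂ {L z})
    (hwL : ∀ z ∈ coneOver U, L z ≠ 0 → L (w z) ∈ Submodule.span ℂ {L z}) :
    ∀ z ∈ coneOver U, L z ≠ 0 →
      L (VectorField.lieBracket ℂ v w z) ∈ Submodule.span ℂ {L z} := by
  intro z hz hLz
  obtain ⟨a, ℓ, ha, hℓ⟩ := hv.exists_fderiv_of_tangent hvL hz hLz
  obtain ⟨b, r, hb, hr⟩ := hw.exists_fderiv_of_tangent hwL hz hLz
  refine Submodule.mem_span_singleton.2 ⟨r (v z) - ℓ (w z), ?_⟩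
  rw [VectorField.lieBracket, map_sub, hr, hℓ, ha, hb]
  module

end LieBracket

/-! ### The two geometric cases. -/

namespace HolomorphicDistribution

open Module Function AlternatingMap

theorem IsTangentToLinearProjection.isIntegrable {n s m : ℕ} {F : HolomorphicDistribution n s}
    (h : F.IsTangentToLinearProjection m) : F.IsIntegrable := by
  obtain ⟨L, -, hL⟩ := h
  intro U v hv w hw
  have hv' := F.homogeneous U v hv
  have hw' := F.homogeneous U w hw
  exact (hL U _ (hv'.lieBracket hw')).2
    (lieBracket_mem_of_tangent hv' hw' ((hL U v hv').1 hv) ((hL U w hw').1 hw))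

/-- `L` is the quotient by `ker ω`, so `ker ω ⊔ span {z}` is the preimage of the line through `L z`.
Where `ω z = 0`, both conditions are void. -/
theorem isTangentToLinearProjection_of_finrank_ker {n k m : ℕ} {F : HolomorphicDistribution n 2}
    {ω : (Fin (n + 1) → ℂ) →ₗ[ℂ] (Fin (n + 1) → ℂ) [⋀^Fin k]→ₗ[ℂ] ℂ} (hm : n = m + 2)
    (hsec : ∀ U v, IsHomogeneousField U v →
      (v ∈ F.sec U ↔ ∀ z ∈ coneOver U, v z ∈ (ω z).kernel))
    (h2 : finrank ℂ (LinearMap.ker ω) = 2)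
    (hker : ∀ z, ω z ≠ 0 → (ω z).kernel = LinearMap.ker ω ⊔ Submodule.span ℂ {z}) :
    F.IsTangentToLinearProjection m := by
  have hfin : finrank ℂ ((Fin (n + 1) → ℂ) ⧸ LinearMap.ker ω) = finrank ℂ (Fin (m + 1) → ℂ) := by
    have := Submodule.finrank_quotient_add_finrank (LinearMap.ker ω)
    rw [h2, finrank_fin_fun] at this
    rw [finrank_fin_fun]
    omega
  let e := LinearEquiv.ofFinrankEq _ _ hfin
  have hL : ∀ z, (e.toLinearMap.comp (LinearMap.ker ω).mkQ) z = 0 ↔ ω z = 0 := fun z => by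
    simp
  have hkerL : LinearMap.ker (e.toLinearMap.comp (LinearMap.ker ω).mkQ) = LinearMap.ker ω := by
    ext z
    exact hL z
  refine ⟨e.toLinearMap.comp (LinearMap.ker ω).mkQ,
    e.surjective.comp (LinearMap.ker ω).mkQ_surjective, fun U v hv => ?_⟩
  rw [hsec U v hv]
  refine forall₂_congr fun z _ => ?_
  rw [Ne, hL z]
  by_cases hz : ω z = 0
  · simp only [hz, not_true_eq_false, false_imp_iff, iff_true]
    exact fun _ _ => rfl
  · rw [hker z hz, ← Set.image_singleton, ← Submodule.map_span, ← Submodule.mem_comap,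
      Submodule.comap_map_eq, hkerL, sup_comm]
    simp only [hz, not_false_eq_true, forall_const]

/-- Take `α = (z i)⁻¹ ^ 2 • T z`, the exponent turning degree `1` into `-1`. On `ker α` the
derivative of the scalar factor drops out of `dα`, leaving `2 * (z i)⁻¹ ^ 2 * T x y`. -/
theorem isContact_of_nondegenerate {F : HolomorphicDistribution 3 2}
    {T : (Fin (3 + 1) → ℂ) →L[ℂ] (Fin (3 + 1) → ℂ) →L[ℂ] ℂ} (hT : ∀ z, T z z = 0)
    (hinj : ∀ z, T z = 0 → z = 0)
    (hsec : ∀ U v, IsHomogeneousField U v → (v ∈ F.sec U ↔ ∀ z ∈ coneOver U, T z (v z) = 0)) :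
    F.IsContact := by
  have hswap : ∀ x y, T y x = -T x y := fun x y => by
    have h := hT (x + y)
    simp only [map_add, _root_.add_apply, hT, zero_add, add_zero] at h
    linear_combination h
  intro p
  obtain ⟨i, z₁, ε, W, hpW, -, hW⟩ := exists_affine_ball_le (U := ⊤) (p := p) trivial
  have hWi : ∀ z ∈ coneOver W, z i ≠ 0 := fun z hz => (hW ▸ hz : z ∈ {z | _ ∧ _}).1
  have hρ : ∀ z ∈ coneOver W, (z i)⁻¹ ^ 2 ≠ 0 := fun z hz =>
    pow_ne_zero 2 (inv_ne_zero (hWi z hz))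
  have hρd : ∀ z ∈ coneOver W,
      DifferentiableAt ℂ (fun z : Fin (3 + 1) → ℂ => (z i)⁻¹ ^ 2) z := by
    intro z hz
    have h : DifferentiableAt ℂ (fun z : Fin (3 + 1) → ℂ => z i) z := differentiableAt_apply i z
    exact (h.fun_inv (hWi z hz)).fun_pow 2
  have hzero : ∀ z ∈ coneOver W, ∀ y, ((z i)⁻¹ ^ 2 • T z) y = 0 ↔ T z y = 0 := by
    intro z hz y
    rw [_root_.smul_apply, smul_eq_mul, mul_eq_zero, or_iff_right (hρ z hz)]
  refine ⟨W, hpW, fun z => (z i)⁻¹ ^ 2 • T z, fun z hz =>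
      ((hρd z hz).fun_smul T.differentiableAt).differentiableWithinAt,
    fun z hz c hc => ?_, fun z hz => (hzero z hz z).2 (hT z), fun z hz h => ?_,
    fun U hU v hv => ?_, fun z hz x hx hxy => ?_⟩
  · change ((c • z) i)⁻¹ ^ 2 • T (c • z) = c⁻¹ • (z i)⁻¹ ^ 2 • T z
    rw [map_smul, smul_smul, smul_smul, Pi.smul_apply, smul_eq_mul]
    congr 1
    have := hWi z hz
    field_simp
  · exact ne_zero_of_mem_coneOver hz (hinj z ((smul_eq_zero.1 h).resolve_left (hρ z hz)))
  · rw [hsec U v hv]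
    exact forall₂_congr fun z hz => (hzero z (coneOver_mono hU hz) _).symm
  · have hder := ((hρd z hz).hasFDerivAt.fun_smul T.hasFDerivAt).fderiv
    rw [hzero z hz] at hx
    have hxy' : ∀ y, T z y = 0 → T x y = 0 := by
      intro y hy
      have h := hxy y ((hzero z hz y).2 hy)
      rw [hder] at h
      simp only [_root_.add_apply, _root_.smul_apply,
        ContinuousLinearMap.smulRight_apply, smul_eq_mul, hy, hx, mul_zero, add_zero,
        hswap x y] at h
      have h4 : (z i)⁻¹ ^ 2 * T x y = 0 := by linear_combination h / 2
      exact (mul_eq_zero.1 h4).resolve_left (hρ z hz)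
    obtain ⟨y₀, hy₀⟩ : ∃ y, T z y ≠ 0 := by
      by_contra! h
      exact ne_zero_of_mem_coneOver hz (hinj z (ContinuousLinearMap.ext h))
    -- `T x` vanishes on the kernel of `T z`, hence is a multiple of it; injectivity of `T`
    -- transfers this to `x` and `z`.
    refine Submodule.mem_span_singleton.2 ⟨T x y₀ / T z y₀, ?_⟩
    refine sub_eq_zero.1 (hinj _ (ContinuousLinearMap.ext fun y => ?_))
    have h := hxy' (y - (T z y / T z y₀) • y₀) (by
      rw [map_sub, map_smul, smul_eq_mul, div_mul_cancel₀ _ hy₀, sub_self])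
    rw [map_sub, map_smul, smul_eq_mul] at h
    simp only [map_sub, map_smul, _root_.sub_apply, _root_.smul_apply,
      smul_eq_mul, _root_.zero_apply]
    linear_combination -h

theorem isContact_of_ker_eq_bot {F : HolomorphicDistribution 3 2}
    {ω : (Fin (3 + 1) → ℂ) →ₗ[ℂ] (Fin (3 + 1) → ℂ) [⋀^Fin 1]→ₗ[ℂ] ℂ}
    (hω : ∀ z, z ∈ (ω z).kernel) (hker : LinearMap.ker ω = ⊥)
    (hsec : ∀ U v, IsHomogeneousField U v →
      (v ∈ F.sec U ↔ ∀ z ∈ coneOver U, v z ∈ (ω z).kernel)) : F.IsContact := by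
  let β : (Fin (3 + 1) → ℂ) →ₗ[ℂ] (Fin (3 + 1) → ℂ) →L[ℂ] ℂ :=
    { toFun := fun z => ((ω z).toMultilinearMap.toLinearMap 0 0).toContinuousLinearMap
      map_add' := fun x y => by ext; simp
      map_smul' := fun c x => by ext; simp }
  have hβ : ∀ z y, β z y = ω z (update 0 0 y) := fun _ _ => rfl
  have hmem : ∀ z y, y ∈ (ω z).kernel ↔ β z y = 0 := by
    intro z y
    rw [hβ, mem_kernel]
    constructor
    · exact fun h => h (0 : Fin 1 → Fin (3 + 1) → ℂ) 0
    intro h x i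
    rw [← h]
    congr 1
    funext j
    rw [Subsingleton.elim i 0, Subsingleton.elim j 0, update_self, update_self]
  refine isContact_of_nondegenerate (T := β.toContinuousLinearMap) (fun z => (hmem z z).1 (hω z))
    (fun z hz => ?_) fun U v hv => ?_
  · have h : ω z = 0 := by
      ext x
      have hx : x = update (0 : Fin 1 → Fin (3 + 1) → ℂ) 0 (x 0) := by
        funext j
        rw [Subsingleton.elim j 0, update_self]
      rw [hx]
      exact congrArg (fun f => f (x 0)) hz
    simpa [hker] using (LinearMap.mem_ker.2 h)
  · rw [hsec U v hv]
    exact forall₂_congr fun z _ => hmem z (v z)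

end HolomorphicDistribution

/-- A distribution of dimension two and degree zero on `P^n` is either integrable and tangent to a
linear projection `P^n ⇢ P^{n-2}`, or `n = 3` and it is a contact structure. -/
theorem mainTheorem12 (n : ℕ) (F : HolomorphicDistribution n 2) (hF : F.HasDegree 0) :
    (F.IsIntegrable ∧ F.IsTangentToLinearProjection (n - 2)) ∨ (n = 3 ∧ F.IsContact) := by
  obtain ⟨ω, hω, hdense, hsec⟩ := F.exists_linear_form_of_hasDegree_zero hF
  have hlt := F.dim_lt
  have hn : n = n - 2 + 2 := by omega
  have hV : Module.finrank ℂ (Fin (n + 1) → ℂ) = n - 2 + 3 := by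
    rw [Module.finrank_fin_fun]
    omega
  have hiff : ∀ U v, IsHomogeneousField U v →
      (v ∈ F.sec U ↔ ∀ z ∈ coneOver U, v z ∈ (ω z).kernel) := fun U v hv =>
    ⟨hsec U v, F.mem_sec_of_forall_mem_kernel hn hsec hdense hv⟩
  have hopen : IsOpen {z | ω z ≠ 0} := (LinearMap.ker ω).closed_of_finiteDimensional.isOpen_compl
  -- At these points the values of sections span three dimensions inside the kernel, and `ω z ≠ 0`
  -- bounds the kernel by three.
  have hG := F.generic_rank.inter_of_isOpen_right hdense hopen
  rcases two_le_finrank_ker_or_ker_eq_bot (by omega) hV hω hG (fun z hz => hz.2) (fun z hz => by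
      have h1 := AlternatingMap.finrank_kernel_add_le hz.2
      have hle : Submodule.span ℂ (F.valuesAt z) ≤ (ω z).kernel := by
        rw [Submodule.span_le]
        rintro _ ⟨U, hU, v, hv, rfl⟩
        exact hsec U v hv z hU
      have h2 := Submodule.finrank_mono hle
      have h3 : Module.finrank ℂ (Submodule.span ℂ (F.valuesAt z)) = 2 + 1 := hz.1
      omega) with h2 | ⟨h1, hbot⟩
  · left
    have hω0 : ω ≠ 0 := by
      rintro rfl
      obtain ⟨z, hz⟩ := hdense.nonempty
      exact hz rfl
    obtain ⟨h2', hker⟩ := finrank_ker_eq_two_and_kernel_eq hV hω hω0 h2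
    have htan := HolomorphicDistribution.isTangentToLinearProjection_of_finrank_ker hn hiff h2' hker
    exact ⟨htan.isIntegrable, htan⟩
  · right
    obtain rfl : n = 3 := by omega
    exact ⟨rfl, HolomorphicDistribution.isContact_of_ker_eq_bot hω hbot hiff⟩
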